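/- Let $\mathcal{GP}_7=\{\tfrac{5x^2-3x}{2} : x\in\mathbb Z\}$ be the set of generalized heptagonal numbers. For a vector $\mathbf a=(a_1,\dots,a_k)$ of positive integers put $V'(\mathbf a)=\{a_1s_1+\cdots+a_ks_k : s_1,\dots,s_k\in\mathcal{GP}_7\}\setminus\{0\}$, the set of nonzero integers represented by the heptagonal form $\sum_{i=1}^k a_i\,\tfrac{5x_i^2-3x_i}{2}$ with $x_1,\dots,x_k\in\mathbb Z$. For a positive integer $n$, let $\mathcal T(n)$ be the set of integers greater than or equal to $n$. The form with coefficient vector $\mathbf a$ is called tight $\mathcal T(n)$-universal if $V'(\mathbf a)=\mathcal T(n)$, and new tight $\mathcal T(n)$-universal if moreover $V'(\mathbf b)\subsetneq\mathcal T(n)$ for every proper subsequence $\mathbf b$ of $\mathbf a$. Proposition. For every integer $n\ge 11$ there are, up to the order of the coefficients, exactly two new tight $\mathcal T(n)$-universal heptagonal forms, namely those with coefficient vectors $$\mathbf x_n=(n,n,n+1,n+2,\dots,2n-1)\quad\text{and}\quad \mathbf y_n=(n,n+1,n+2,\dots,2n).$$ -/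

import Mathlib

namespace TightUniversal

/-- The polynomial `P_m(x) = ((m - 2) x ^ 2 - (m - 4) x) / 2`, for integers `x`.
The integer division is exact, see `two_mul_polygonal`. -/
def polygonal (m : ℕ) (x : ℤ) : ℤ :=
  (((m : ℤ) - 2) * x ^ 2 - ((m : ℤ) - 4) * x) / 2

theorem two_mul_polygonal (m : ℕ) (x : ℤ) :
    2 * polygonal m x = ((m : ℤ) - 2) * x ^ 2 - ((m : ℤ) - 4) * x := by
  unfold polygonal
  apply Int.mul_ediv_cancel'
  have h : ((m : ℤ) - 2) * x ^ 2 - ((m : ℤ) - 4) * x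
      = ((m : ℤ) - 2) * (x * (x - 1)) + 2 * x := by ring
  rw [h]
  exact dvd_add ((Int.even_mul_pred_self x).two_dvd.mul_left _) (dvd_mul_right _ _)

/-- The set of generalized `m`-gonal numbers. -/
def generalizedPolygonal (m : ℕ) : Set ℤ :=
  Set.range (polygonal m)

/-- `V_S(a) = {a_1 s_1 + ... + a_k s_k : s_i ∈ S}` for a vector `a = (a_1, ..., a_k)`.
For `S = generalizedPolygonal m` this is the set of integers represented by the `m`-gonal form
with coefficient vector `a`. -/
def representedSet (S : Set ℤ) (a : List ℕ) : Set ℤ :=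
  {N | ∃ s : Fin a.length → ℤ, (∀ i, s i ∈ S) ∧ N = ∑ i : Fin a.length, (a.get i : ℤ) * s i}

/-- `V'_S(a)`, the set `V_S(a)` without `0`. -/
def representedSet' (S : Set ℤ) (a : List ℕ) : Set ℤ :=
  representedSet S a \ {0}

/-- `T(n)`, the set of integers greater than or equal to `n`. -/
def T (n : ℕ) : Set ℤ :=
  Set.Ici (n : ℤ)

/-- The vector `a` of positive integers is tight `T(n)`-universal with respect to `S`. -/
def IsTight (S : Set ℤ) (n : ℕ) (a : List ℕ) : Prop :=
  (∀ c ∈ a, 0 < c) ∧ representedSet' S a = T n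

/-- `b` is a proper subsequence of `a`. -/
def ProperSubsequence (b a : List ℕ) : Prop :=
  b.Sublist a ∧ b ≠ a

/-- The vector `a` of positive integers is new tight `T(n)`-universal with respect to `S`. -/
def IsNewTight (S : Set ℤ) (n : ℕ) (a : List ℕ) : Prop :=
  IsTight S n a ∧ ∀ b : List ℕ, ProperSubsequence b a → representedSet' S b ⊂ T n

/-- `x_n = (n, n, n + 1, ..., 2 n - 1)`. -/
def xVec (n : ℕ) : List ℕ :=
  n :: List.range' n n

/-- `y_n = (n, n + 1, ..., 2 n)`. -/
def yVec (n : ℕ) : List ℕ :=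
  List.range' n (n + 1)

end TightUniversal

/-! Necessity uses only that 0 and 1 are heptagonal and all other values are at least 3. In a tight
vector every coefficient is at least n, so each of n, ..., 2n-1 must itself be a coefficient, and 2n
forces either a coefficient 2n or a second n. Hence a tight vector contains `xVec n` or `yVec n`
(`xVec_subperm_or_yVec_subperm`). Once these two are tight, minimality leaves nothing else
(`isNewTight_iff_perm`).

Sufficiency concerns e, n, ..., 2n-1 with e = n or 2n (`mem_cons_range'`). Some coefficients are
paired with constant sum, and arguments are chosen so that the linear terms cancel; Lagrange's
four-square theorem then yields all multiples of some D. The other coefficients need only cover D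
consecutive integers, possibly up to multiples of D (`mem_append_of_interval`). For n ≥ 34 subset
sums of the middle coefficients do so; for smaller n a kernel computation with bit masks does. -/

namespace TightUniversal

/-! ### Basic properties of represented sets -/

section Represented

variable {S : Set ℤ}

theorem mem_representedSet_nil {N : ℤ} : N ∈ representedSet S [] ↔ N = 0 := by
  constructor
  · rintro ⟨s, -, h⟩
    simpa using h
  · rintro rfl
    exact ⟨fun _ => 0, fun i => i.elim0, by simp⟩

theorem mem_representedSet_cons {c : ℕ} {a : List ℕ} {N : ℤ} :
    N ∈ representedSet S (c :: a) ↔ ∃ s ∈ S, ∃ M ∈ representedSet S a, N = c * s + M := by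
  constructor
  · rintro ⟨s, hs, h⟩
    refine ⟨s ⟨0, by simp⟩, hs _, _, ⟨fun i => s i.succ, fun i => hs _, rfl⟩, ?_⟩
    rw [h]
    exact Fin.sum_univ_succ (n := a.length) _
  · rintro ⟨s, hs, M, ⟨t, ht, rfl⟩, rfl⟩
    refine ⟨Fin.cons (n := a.length) (α := fun _ => ℤ) s t, ?_, ?_⟩
    · intro i
      refine Fin.cases (n := a.length) ?_ ?_ i
      · simpa using hs
      · intro j
        simpa using ht j
    · symm
      exact Fin.sum_univ_succ (n := a.length) _

theorem representedSet_perm {a b : List ℕ} (h : a.Perm b) :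
    representedSet S a = representedSet S b := by
  induction h with
  | nil => rfl
  | cons c _ ih =>
    ext N
    simp only [mem_representedSet_cons, ih]
  | swap c d l =>
    ext N
    simp only [mem_representedSet_cons]
    constructor <;>
    · rintro ⟨s, hs, M, ⟨t, ht, K, hK, rfl⟩, rfl⟩
      exact ⟨t, ht, _, ⟨s, hs, K, hK, rfl⟩, by ring⟩
  | trans _ _ ih₁ ih₂ => exact ih₁.trans ih₂

theorem add_mem_representedSet_append {a b : List ℕ} {M N : ℤ}
    (hM : M ∈ representedSet S a) (hN : N ∈ representedSet S b) :
    M + N ∈ representedSet S (a ++ b) := by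
  induction a generalizing M with
  | nil =>
    rw [mem_representedSet_nil] at hM
    simpa [hM] using hN
  | cons c a ih =>
    obtain ⟨s, hs, K, hK, rfl⟩ := mem_representedSet_cons.1 hM
    exact mem_representedSet_cons.2 ⟨s, hs, _, ih hK, by ring⟩

theorem representedSet_mono_of_sublist (h0 : (0 : ℤ) ∈ S) {a b : List ℕ} (h : a.Sublist b) :
    representedSet S a ⊆ representedSet S b := by
  induction h with
  | slnil => exact subset_rfl
  | cons c _ ih =>
    intro N hN
    exact mem_representedSet_cons.2 ⟨0, h0, N, ih hN, by ring⟩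
  | cons_cons c _ ih =>
    intro N hN
    obtain ⟨s, hs, K, hK, rfl⟩ := mem_representedSet_cons.1 hN
    exact mem_representedSet_cons.2 ⟨s, hs, K, ih hK, rfl⟩

theorem coe_mem_representedSet_of_mem (h0 : (0 : ℤ) ∈ S) (h1 : (1 : ℤ) ∈ S) {a : List ℕ} {c : ℕ}
    (hc : c ∈ a) : (c : ℤ) ∈ representedSet S a := by
  apply representedSet_mono_of_sublist h0 (List.singleton_sublist.2 hc)
  exact mem_representedSet_cons.2 ⟨1, h1, 0, mem_representedSet_nil.2 rfl, by ring⟩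

end Represented

/-! ### Representations of integers up to 2n -/

section SmallValues

variable {S : Set ℤ} {n : ℕ}

theorem eq_zero_or_le_of_mem_representedSet (hS : ∀ s ∈ S, s = 0 ∨ s = 1 ∨ 3 ≤ s) {a : List ℕ}
    (ha : ∀ c ∈ a, n ≤ c) {N : ℤ} (hN : N ∈ representedSet S a) : N = 0 ∨ (n : ℤ) ≤ N := by
  induction a generalizing N with
  | nil => exact Or.inl (mem_representedSet_nil.1 hN)
  | cons c a ih =>
    obtain ⟨s, hs, K, hK, rfl⟩ := mem_representedSet_cons.1 hN
    have hc : (n : ℤ) ≤ c := by exact_mod_cast ha c (by simp)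
    have hK' := ih (fun d hd => ha d (by simp [hd])) hK
    rcases hS s hs with rfl | rfl | h
    · simpa using hK'
    · right
      omega
    · right
      have : (c : ℤ) * 3 ≤ c * s := by gcongr
      omega

/-- A value at least 3 contributes at least 3n, and two nonzero terms at least 2n, so a single
coefficient with value 1 remains. -/
theorem mem_of_mem_representedSet_of_lt (hS : ∀ s ∈ S, s = 0 ∨ s = 1 ∨ 3 ≤ s) {a : List ℕ}
    (ha : ∀ c ∈ a, n ≤ c) {N : ℕ} (hN : (N : ℤ) ∈ representedSet S a) (h0 : 0 < N)
    (hlt : N < 2 * n) : N ∈ a := by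
  induction a with
  | nil =>
    have := mem_representedSet_nil.1 hN
    omega
  | cons c a ih =>
    obtain ⟨s, hs, K, hK, h⟩ := mem_representedSet_cons.1 hN
    have hc : n ≤ c := ha c (by simp)
    have ha' : ∀ d ∈ a, n ≤ d := fun d hd => ha d (by simp [hd])
    have hK' := eq_zero_or_le_of_mem_representedSet hS ha' hK
    rcases hS s hs with rfl | rfl | h3
    · rw [mul_zero, zero_add] at h
      exact List.mem_cons_of_mem _ (ih ha' (h ▸ hK))
    · have : N = c := by omega
      simp [this]
    · have : (c : ℤ) * 3 ≤ c * s := by gcongr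
      omega

/-- As below 2n, except that two terms with value 1 now fit, and only as n + n. -/
theorem two_mul_mem_or_two_le_count (hS : ∀ s ∈ S, s = 0 ∨ s = 1 ∨ 3 ≤ s) (hn : 0 < n)
    {a : List ℕ} (ha : ∀ c ∈ a, n ≤ c) (hN : ((2 * n : ℕ) : ℤ) ∈ representedSet S a) :
    2 * n ∈ a ∨ 2 ≤ a.count n := by
  induction a with
  | nil =>
    have := mem_representedSet_nil.1 hN
    omega
  | cons c a ih =>
    obtain ⟨s, hs, K, hK, h⟩ := mem_representedSet_cons.1 hN
    have hc : n ≤ c := ha c (by simp)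
    have ha' : ∀ d ∈ a, n ≤ d := fun d hd => ha d (by simp [hd])
    have hK' := eq_zero_or_le_of_mem_representedSet hS ha' hK
    rcases hS s hs with rfl | rfl | h3
    · rw [mul_zero, zero_add] at h
      rcases ih ha' (h ▸ hK) with h | h
      · exact Or.inl (by simp [h])
      · exact Or.inr (h.trans (List.count_le_count_cons))
    · rcases hK' with rfl | hK'
      · left
        have : 2 * n = c := by omega
        simp [this]
      · right
        obtain rfl : c = n := by omega
        obtain rfl : K = (c : ℤ) := by omega
        have : c ∈ a := mem_of_mem_representedSet_of_lt hS ha' hK hn (by omega)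
        have := List.count_pos_iff.2 this
        rw [List.count_cons_self]
        omega
    · have : (c : ℤ) * 3 ≤ c * s := by gcongr
      omega

end SmallValues

/-! ### Necessity and minimality -/

section Uniqueness

variable {S : Set ℤ} {n : ℕ}

theorem le_of_mem_of_isTight (h0 : (0 : ℤ) ∈ S) (h1 : (1 : ℤ) ∈ S) {a : List ℕ}
    (ha : IsTight S n a) {c : ℕ} (hc : c ∈ a) : n ≤ c := by
  have hpos := ha.1 c hc
  have : (c : ℤ) ∈ representedSet' S a :=
    ⟨coe_mem_representedSet_of_mem h0 h1 hc, by simpa using hpos.ne'⟩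
  rw [ha.2] at this
  exact_mod_cast (show (n : ℤ) ≤ c from this)

theorem xVec_subperm_or_yVec_subperm (h0 : (0 : ℤ) ∈ S) (h1 : (1 : ℤ) ∈ S)
    (hS : ∀ s ∈ S, s = 0 ∨ s = 1 ∨ 3 ≤ s) (hn : 0 < n) {a : List ℕ} (ha : IsTight S n a) :
    (xVec n).Subperm a ∨ (yVec n).Subperm a := by
  have hle : ∀ c ∈ a, n ≤ c := fun c hc => le_of_mem_of_isTight h0 h1 ha hc
  have hrep : ∀ N : ℕ, n ≤ N → (N : ℤ) ∈ representedSet S a := fun N hN => by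
    have : (N : ℤ) ∈ T n := show (n : ℤ) ≤ N by exact_mod_cast hN
    rw [← ha.2] at this
    exact this.1
  have hmem : ∀ N, n ≤ N → N < 2 * n → N ∈ a := fun N h₁ h₂ =>
    mem_of_mem_representedSet_of_lt hS hle (hrep N h₁) (by omega) h₂
  rcases two_mul_mem_or_two_le_count hS hn hle (hrep (2 * n) (by omega)) with h | h
  · right
    apply List.subperm_of_subset (List.nodup_range')
    intro N hN
    rw [List.mem_range'_1] at hN
    rcases eq_or_ne N (2 * n) with rfl | hne
    · exact h
    · exact hmem N hN.1 (by omega)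
  · left
    have hna : n ∈ a := List.count_pos_iff.1 (by omega)
    refine List.Subperm.trans ?_ (List.perm_cons_erase hna).symm.subperm
    refine (List.subperm_cons n).2 ?_
    apply List.subperm_of_subset (List.nodup_range')
    intro N hN
    rw [List.mem_range'_1] at hN
    rcases eq_or_ne N n with rfl | hne
    · rw [← List.count_pos_iff, List.count_erase_self]
      omega
    · exact (List.mem_erase_of_ne hne).2 (hmem N hN.1 (by omega))

theorem isTight_of_perm {a b : List ℕ} (h : a.Perm b) (hb : IsTight S n b) : IsTight S n a := by
  refine ⟨fun c hc => hb.1 c (h.subset hc), ?_⟩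
  rw [← hb.2, representedSet', representedSet', representedSet_perm h]

theorem isNewTight_iff_perm (h0 : (0 : ℤ) ∈ S) (h1 : (1 : ℤ) ∈ S)
    (hS : ∀ s ∈ S, s = 0 ∨ s = 1 ∨ 3 ≤ s) (hn : 0 < n)
    (hx : IsTight S n (xVec n)) (hy : IsTight S n (yVec n)) (a : List ℕ) :
    IsNewTight S n a ↔ a.Perm (xVec n) ∨ a.Perm (yVec n) := by
  constructor
  · rintro ⟨ha, hnew⟩
    have key : ∀ v : List ℕ, IsTight S n v → v.Subperm a → a.Perm v := by
      rintro v hv ⟨l, hl, hla⟩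
      by_cases hne : l = a
      · exact hne ▸ hl
      · exact absurd (isTight_of_perm hl hv).2 (hnew l ⟨hla, hne⟩).ne
    exact (xVec_subperm_or_yVec_subperm h0 h1 hS hn ha).imp (key _ hx) (key _ hy)
  · intro h
    have ha : IsTight S n a := h.elim (fun h => isTight_of_perm h hx) fun h => isTight_of_perm h hy
    have hlen : a.length = n + 1 := by
      rcases h with h | h <;> simp [h.length_eq, xVec, yVec]
    refine ⟨ha, fun b hb => ?_⟩
    have hsub : representedSet' S b ⊆ T n := by
      rw [← ha.2]
      exact Set.sdiff_subset_sdiff_left (representedSet_mono_of_sublist h0 hb.1)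
    refine hsub.ssubset_of_ne fun heq => ?_
    have hb' : IsTight S n b := ⟨fun c hc => ha.1 c (hb.1.subset hc), heq⟩
    have hlt : b.length < a.length :=
      lt_of_le_of_ne hb.1.length_le fun h => hb.2 (hb.1.eq_of_length h)
    -- A tight vector has length at least n + 1, which a proper subsequence cannot reach.
    rcases xVec_subperm_or_yVec_subperm h0 h1 hS hn hb' with h | h <;>
    · have := h.length_le
      simp [xVec, yVec] at this
      omega

theorem isTight_of_forall_mem (hS : ∀ s ∈ S, s = 0 ∨ s = 1 ∨ 3 ≤ s) (hn : 0 < n) {a : List ℕ}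
    (ha : ∀ c ∈ a, n ≤ c) (h : ∀ N : ℕ, n ≤ N → (N : ℤ) ∈ representedSet S a) :
    IsTight S n a := by
  refine ⟨fun c hc => hn.trans_le (ha c hc), Set.Subset.antisymm ?_ ?_⟩
  · rintro N ⟨hN, hN0⟩
    exact (eq_zero_or_le_of_mem_representedSet hS ha hN).resolve_left hN0
  · intro N hN
    have hN' : (n : ℤ) ≤ N := hN
    lift N to ℕ using by omega
    refine ⟨h N (by omega), ?_⟩
    simp only [Set.mem_singleton_iff]
    omega

theorem not_xVec_perm_yVec (hn : 0 < n) : ¬ (xVec n).Perm (yVec n) := by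
  intro h
  have : 2 * n ∈ xVec n := h.symm.subset (List.mem_range'_1.2 (by omega))
  rw [xVec, List.mem_cons, List.mem_range'_1] at this
  omega

end Uniqueness

/-! ### Heptagonal numbers and representing all multiples of a modulus -/

theorem zero_mem_heptagonal : (0 : ℤ) ∈ generalizedPolygonal 7 := ⟨0, by decide⟩

theorem one_mem_heptagonal : (1 : ℤ) ∈ generalizedPolygonal 7 := ⟨1, by decide⟩

theorem two_mul_heptagonal (x : ℤ) : 2 * polygonal 7 x = 5 * x ^ 2 - 3 * x := by
  rw [two_mul_polygonal]
  norm_num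

theorem heptagonal_eq_zero_or_one_or_three_le :
    ∀ s ∈ generalizedPolygonal 7, s = 0 ∨ s = 1 ∨ 3 ≤ s := by
  rintro _ ⟨x, rfl⟩
  have h := two_mul_heptagonal x
  rcases lt_trichotomy x 0 with hx | rfl | hx
  · have : 6 < 5 * x ^ 2 - 3 * x := by nlinarith
    omega
  · left
    omega
  · rcases eq_or_lt_of_le (show 1 ≤ x from hx) with rfl | hx
    · right; left
      omega
    · have : 6 ≤ 5 * x ^ 2 - 3 * x := by nlinarith
      omega

theorem cons_mem (x : ℤ) {c : ℕ} {a : List ℕ} {N : ℤ}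
    (h : N - c * polygonal 7 x ∈ representedSet (generalizedPolygonal 7) a) :
    N ∈ representedSet (generalizedPolygonal 7) (c :: a) :=
  mem_representedSet_cons.2 ⟨_, ⟨x, rfl⟩, _, h, by ring⟩

/-- Four quadruples of coefficients, each consisting of two pairs with sum `m`, represent all
multiples of `5 m`. -/
theorem multiples_mem_of_eight_pairs {m a₁ a₂ a₃ a₄ a₅ a₆ a₇ a₈ b₁ b₂ b₃ b₄ b₅ b₆ b₇ b₈ : ℕ}
    (h₁ : a₁ + b₁ = m) (h₂ : a₂ + b₂ = m) (h₃ : a₃ + b₃ = m) (h₄ : a₄ + b₄ = m)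
    (h₅ : a₅ + b₅ = m) (h₆ : a₆ + b₆ = m) (h₇ : a₇ + b₇ = m) (h₈ : a₈ + b₈ = m) (k : ℕ) :
    ((5 * m * k : ℕ) : ℤ) ∈ representedSet (generalizedPolygonal 7)
      [a₁, a₂, a₃, a₄, a₅, a₆, a₇, a₈, b₁, b₂, b₃, b₄, b₅, b₆, b₇, b₈] := by
  obtain ⟨p, q, r, s, rfl⟩ := Nat.sum_four_squares k
  have hp := two_mul_heptagonal p
  have hq := two_mul_heptagonal q
  have hr := two_mul_heptagonal r
  have hs := two_mul_heptagonal s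
  have hp' := two_mul_heptagonal (-p)
  have hq' := two_mul_heptagonal (-q)
  have hr' := two_mul_heptagonal (-r)
  have hs' := two_mul_heptagonal (-s)
  -- Both members of a pair get the same argument. Two pairs with arguments p and -p contribute
  -- m(P(p) + P(-p)) = 5mp².
  refine cons_mem p <| cons_mem (-p) <| cons_mem q <| cons_mem (-q) <| cons_mem r <|
    cons_mem (-r) <| cons_mem s <| cons_mem (-s) <| cons_mem p <| cons_mem (-p) <| cons_mem q <|
    cons_mem (-q) <| cons_mem r <| cons_mem (-r) <| cons_mem s <| cons_mem (-s) <|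
    mem_representedSet_nil.2 ?_
  obtain rfl : b₁ = m - a₁ := by omega
  have e₁ : ((m - a₁ : ℕ) : ℤ) = m - a₁ := by omega
  have e₂ : (b₂ : ℤ) = m - a₂ := by omega
  have e₃ : (b₃ : ℤ) = m - a₃ := by omega
  have e₄ : (b₄ : ℤ) = m - a₄ := by omega
  have e₅ : (b₅ : ℤ) = m - a₅ := by omega
  have e₆ : (b₆ : ℤ) = m - a₆ := by omega
  have e₇ : (b₇ : ℤ) = m - a₇ := by omega
  have e₈ : (b₈ : ℤ) = m - a₈ := by omega
  rw [e₁, e₂, e₃, e₄, e₅, e₆, e₇, e₈]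
  apply mul_left_cancel₀ (two_ne_zero (α := ℤ))
  push_cast
  linear_combination (-(m : ℤ)) * (hp + hp' + hq + hq' + hr + hr' + hs + hs')

/-- In a four-square representation of a multiple of 3 some term is divisible by 3, since otherwise
the sum would be 4 ≡ 1 mod 3. -/
theorem exists_sum_three_squares_add_nine_sq (k : ℕ) :
    ∃ p q r s : ℤ, p ^ 2 + q ^ 2 + r ^ 2 + 9 * s ^ 2 = 3 * k := by
  obtain ⟨p, q, r, s, h⟩ := Nat.sum_four_squares (3 * k)
  have key : ∀ p q r s : ℕ, p ^ 2 + q ^ 2 + r ^ 2 + s ^ 2 = 3 * k → 3 ∣ s →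
      ∃ p q r s : ℤ, p ^ 2 + q ^ 2 + r ^ 2 + 9 * s ^ 2 = 3 * k := by
    rintro p q r _ h ⟨s, rfl⟩
    refine ⟨p, q, r, s, ?_⟩
    have : (((p ^ 2 + q ^ 2 + r ^ 2 + (3 * s) ^ 2 : ℕ)) : ℤ) = (3 * k : ℕ) := by rw [h]
    push_cast at this
    linarith
  have hsq : ∀ x : ℕ, 3 ∣ x ∨ x ^ 2 % 3 = 1 := fun x => by
    have : x % 3 = 0 ∨ x % 3 = 1 ∨ x % 3 = 2 := by omega
    rcases this with h | h | h
    · exact Or.inl (Nat.dvd_of_mod_eq_zero h)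
    · right; simp [Nat.pow_mod, h]
    · right; simp [Nat.pow_mod, h]
  rcases hsq s with hs | hs
  · exact key p q r s h hs
  rcases hsq r with hr | hr
  · exact key p q s r (by omega) hr
  rcases hsq q with hq | hq
  · exact key p r s q (by omega) hq
  rcases hsq p with hp | hp
  · exact key q r s p (by omega) hp
  omega

/-- Four pairs of coefficients with sum `2 w`, together with `w`, represent all multiples
of `60 w`. -/
theorem multiples_mem_of_four_pairs {w a₁ a₂ a₃ a₄ b₁ b₂ b₃ b₄ : ℕ}
    (h₁ : a₁ + b₁ = 2 * w) (h₂ : a₂ + b₂ = 2 * w) (h₃ : a₃ + b₃ = 2 * w) (h₄ : a₄ + b₄ = 2 * w)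
    (k : ℕ) :
    ((60 * w * k : ℕ) : ℤ) ∈ representedSet (generalizedPolygonal 7)
      [w, a₁, b₁, a₂, b₂, a₃, b₃, a₄, b₄] := by
  obtain ⟨p, q, r, s, h⟩ := exists_sum_three_squares_add_nine_sq k
  have H := two_mul_heptagonal (-8 * s)
  have H₁ := two_mul_heptagonal (p + q + r + s)
  have H₂ := two_mul_heptagonal (p - q - r + s)
  have H₃ := two_mul_heptagonal (-p + q - r + s)
  have H₄ := two_mul_heptagonal (-p - q + r + s)
  -- The four pair arguments sum to 4s and their squares to 4(p² + q² + r² + s²). As the pairs have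
  -- weight 2w, the argument -8s on w cancels the linear terms, leaving 20w(p² + q² + r² + 9s²).
  refine cons_mem (-8 * s) <| cons_mem (p + q + r + s) <| cons_mem (p + q + r + s) <|
    cons_mem (p - q - r + s) <| cons_mem (p - q - r + s) <| cons_mem (-p + q - r + s) <|
    cons_mem (-p + q - r + s) <| cons_mem (-p - q + r + s) <| cons_mem (-p - q + r + s) <|
    mem_representedSet_nil.2 ?_
  have e₁ : (b₁ : ℤ) = 2 * w - a₁ := by omega
  have e₂ : (b₂ : ℤ) = 2 * w - a₂ := by omega
  have e₃ : (b₃ : ℤ) = 2 * w - a₃ := by omega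
  have e₄ : (b₄ : ℤ) = 2 * w - a₄ := by omega
  rw [e₁, e₂, e₃, e₄]
  apply mul_left_cancel₀ (two_ne_zero (α := ℤ))
  push_cast
  linear_combination (-(w : ℤ)) * (H + 2 * H₁ + 2 * H₂ + 2 * H₃ + 2 * H₄) - 40 * w * h

/-- If `G` represents all multiples of `D` and `R` represents, up to multiples of `D`, all integers
of an interval of length `D`, then `G ++ R` represents all integers from that interval on. -/
theorem mem_append_of_interval {S : Set ℤ} {G R : List ℕ} {A D : ℕ} (hD : 0 < D)
    (hG : ∀ k : ℕ, ((D * k : ℕ) : ℤ) ∈ representedSet S G)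
    (hR : ∀ t, A ≤ t → t < A + D → ∃ j r : ℕ, t = D * j + r ∧ (r : ℤ) ∈ representedSet S R)
    {N : ℕ} (hN : A ≤ N) : (N : ℤ) ∈ representedSet S (G ++ R) := by
  have hdiv := Nat.div_add_mod (N - A) D
  have hmod := Nat.mod_lt (N - A) hD
  obtain ⟨j, r, ht, hr⟩ := hR (A + (N - A) % D) (by omega) (by omega)
  have : (N : ℤ) = ((D * ((N - A) / D + j) : ℕ) : ℤ) + r := by
    rw [mul_add]
    omega
  rw [this]
  exact add_mem_representedSet_append (hG _) hr

/-! ### Verified computation with bit masks -/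

section Masks

/-- The first generalized heptagonal numbers. -/
def smallHeptagonal : List ℕ :=
  [0, 1, 4, 7, 13, 18, 27, 34, 46, 55, 70, 81, 99, 112, 133, 148, 172, 189, 216, 235, 265, 286]

theorem smallHeptagonal_mem : ∀ s ∈ smallHeptagonal, (s : ℤ) ∈ generalizedPolygonal 7 := by
  have : ∀ s ∈ smallHeptagonal, ∃ x ∈ Finset.Icc (-11 : ℤ) 11, polygonal 7 x = s := by
    decide +kernel
  intro s hs
  obtain ⟨x, -, hx⟩ := this s hs
  exact ⟨x, hx⟩

/-- The union of the translates `m <<< (c * s)` of a bit mask `m`, for `s` in a list. -/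
def shiftUnion (c m : ℕ) : List ℕ → ℕ
  | [] => 0
  | s :: l => m <<< (c * s) ||| shiftUnion c m l

theorem testBit_shiftUnion {c m : ℕ} {l : List ℕ} {N : ℕ} (h : (shiftUnion c m l).testBit N) :
    ∃ s ∈ l, ∃ M, m.testBit M ∧ N = c * s + M := by
  induction l with
  | nil => simp [shiftUnion] at h
  | cons s l ih =>
    rw [shiftUnion, Nat.testBit_or, Bool.or_eq_true, Nat.testBit_shiftLeft, Bool.and_eq_true,
      decide_eq_true_eq] at h
    rcases h with h | h
    · exact ⟨s, by simp, _, h.2, by omega⟩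
    · obtain ⟨t, ht, M, hM⟩ := ih h
      exact ⟨t, by simp [ht], M, hM⟩

/-- A bit mask of integers represented by a list of coefficients, with values taken from `l`. -/
def mask (l : List ℕ) : List ℕ → ℕ
  | [] => 1
  | c :: a => shiftUnion c (mask l a) l

theorem mem_of_testBit_mask {S : Set ℤ} {l : List ℕ} (hl : ∀ s ∈ l, (s : ℤ) ∈ S) {a : List ℕ}
    {N : ℕ} (h : (mask l a).testBit N) : (N : ℤ) ∈ representedSet S a := by
  induction a generalizing N with
  | nil =>
    rw [mask, Nat.testBit_one_eq_true_iff_self_eq_zero] at h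
    simp [mem_representedSet_nil, h]
  | cons c a ih =>
    obtain ⟨s, hs, M, hM, rfl⟩ := testBit_shiftUnion h
    exact mem_representedSet_cons.2 ⟨s, hl s hs, M, ih hM, by push_cast; ring⟩

theorem testBit_of_shiftRight_land {m A D : ℕ} (h : (m >>> A) &&& (2 ^ D - 1) = 2 ^ D - 1) {t : ℕ}
    (h₁ : A ≤ t) (h₂ : t < A + D) : m.testBit t := by
  have := congrArg (fun x => Nat.testBit x (t - A)) h
  simp only [Nat.testBit_and, Nat.testBit_shiftRight, Nat.testBit_two_pow_sub_one] at this
  rw [show A + (t - A) = t by omega] at this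
  simpa [show t - A < D by omega] using this

/-- The check that the coefficients `R` represent modulo `D` a full interval from `A` on,
and that the coefficients `a` represent all of `n, ..., A - 1`, with values taken from given
lists. -/
def maskCheck (n A D : ℕ) (l l' : List ℕ) (a R : List ℕ) : Bool :=
  -- In every application A + D < 16 D, so sixteen translates lose nothing.
  Nat.beq ((shiftUnion D (mask l R) (List.range 16) >>> A) &&& (2 ^ D - 1)) (2 ^ D - 1) &&
  Nat.beq ((mask l' a >>> n) &&& (2 ^ (A - n) - 1)) (2 ^ (A - n) - 1)

theorem mem_of_maskCheck {S : Set ℤ} {n A D : ℕ} {l l' a G R : List ℕ} (hD : 0 < D)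
    (hl : ∀ s ∈ l, (s : ℤ) ∈ S) (hl' : ∀ s ∈ l', (s : ℤ) ∈ S)
    (hG : ∀ k : ℕ, ((D * k : ℕ) : ℤ) ∈ representedSet S G) (hperm : a.Perm (G ++ R))
    (h : maskCheck n A D l l' a R) {N : ℕ} (hN : n ≤ N) : (N : ℤ) ∈ representedSet S a := by
  rw [maskCheck, Bool.and_eq_true] at h
  rcases lt_or_ge N A with hA | hA
  · exact mem_of_testBit_mask hl'
      (testBit_of_shiftRight_land (Nat.eq_of_beq_eq_true h.2) hN (by omega))
  · rw [representedSet_perm hperm]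
    refine mem_append_of_interval hD hG (fun t h₁ h₂ => ?_) hA
    obtain ⟨j, -, r, hr, ht⟩ :=
      testBit_shiftUnion (testBit_of_shiftRight_land (Nat.eq_of_beq_eq_true h.1) h₁ h₂)
    exact ⟨j, r, ht, mem_of_testBit_mask hl hr⟩

end Masks

/-! ### The cases 11 ≤ n < 34 -/

section SmallCases

theorem mem_cons_range'_eleven {e : ℕ} (he : e = 11 ∨ e = 2 * 11) {N : ℕ} (hN : 11 ≤ N) :
    (N : ℤ) ∈ representedSet (generalizedPolygonal 7) (e :: List.range' 11 11) := by
  have hG : ∀ k : ℕ, ((60 * 16 * k : ℕ) : ℤ) ∈ representedSet (generalizedPolygonal 7)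
      -- The pairs sum to 32 but are not the nine central integers: 13 and 19 are kept, with e, for
      -- the residues modulo 960.
      [16, 11, 21, 12, 20, 14, 18, 15, 17] :=
    multiples_mem_of_four_pairs (by norm_num) (by norm_num) (by norm_num) (by norm_num)
  have hl' : ∀ s ∈ smallHeptagonal.take 10, (s : ℤ) ∈ generalizedPolygonal 7 :=
    fun s hs => smallHeptagonal_mem s (List.mem_of_mem_take hs)
  rcases he with rfl | rfl
  · exact mem_of_maskCheck (A := 6418) (D := 60 * 16) (R := [11, 13, 19]) (by norm_num)
      smallHeptagonal_mem hl' hG (by decide +kernel) (by decide +kernel) hN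
  · exact mem_of_maskCheck (A := 6418) (D := 60 * 16) (R := [2 * 11, 13, 19]) (by norm_num)
      smallHeptagonal_mem hl' hG (by decide +kernel) (by decide +kernel) hN

/-- The nine integers around `w`. -/
def centralBlock (w : ℕ) : List ℕ :=
  [w, w - 1, w + 1, w - 2, w + 2, w - 3, w + 3, w - 4, w + 4]

/-- The vector `(e, n, n + 1, ..., 2 n - 1)` without the nine integers around `w`. -/
def outerBlocks (e n w : ℕ) : List ℕ :=
  e :: (List.range' n (w - 4 - n) ++ List.range' (w + 5) (2 * n - w - 5))

theorem maskCheck_of_lt : ∀ n < 34, 12 ≤ n → ∀ e ∈ [n, 2 * n],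
    (e :: List.range' n n).isPerm (centralBlock (3 * n / 2) ++ outerBlocks e n (3 * n / 2)) ∧
    maskCheck n 1137 (60 * (3 * n / 2)) (smallHeptagonal.take 14) (smallHeptagonal.take 4)
      (e :: List.range' n n) (outerBlocks e n (3 * n / 2)) := by
  decide +kernel

theorem mem_cons_range'_of_lt {n e : ℕ} (h₁ : 12 ≤ n) (h₂ : n < 34) (he : e = n ∨ e = 2 * n)
    {N : ℕ} (hN : n ≤ N) :
    (N : ℤ) ∈ representedSet (generalizedPolygonal 7) (e :: List.range' n n) := by
  obtain ⟨hperm, hcheck⟩ := maskCheck_of_lt n h₂ h₁ e (by simpa using he)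
  refine mem_of_maskCheck (by omega)
    (fun s hs => smallHeptagonal_mem s (List.mem_of_mem_take hs))
    (fun s hs => smallHeptagonal_mem s (List.mem_of_mem_take hs))
    (multiples_mem_of_four_pairs ?_ ?_ ?_ ?_) (List.isPerm_iff.1 hperm) hcheck hN <;> omega

end SmallCases

/-! ### The cases n ≥ 34 -/

section LargeCases

/-- The sums of `k` elements of `{l, ..., l + m - 1}` form an interval. -/
theorem subsetSum_mem_range' {S : Set ℤ} (h0 : (0 : ℤ) ∈ S) (h1 : (1 : ℤ) ∈ S) {k l m t : ℕ}
    (hkm : k ≤ m) (hlo : 2 * (k * l) + k * k ≤ 2 * t + k)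
    (hhi : 2 * t + k + k * k ≤ 2 * (k * l) + 2 * (k * m)) :
    (t : ℤ) ∈ representedSet S (List.range' l m) := by
  induction m generalizing k t with
  | zero =>
    obtain rfl : k = 0 := by omega
    simp only [Nat.zero_mul, Nat.mul_zero] at hlo hhi
    simp [mem_representedSet_nil]
    omega
  | succ m ih =>
    rw [List.range'_concat, one_mul]
    rcases k with _ | k
    · have : t = 0 := by omega
      subst this
      exact representedSet_mono_of_sublist h0 (List.nil_sublist _)
        (mem_representedSet_nil.2 (by simp))
    -- The largest element l + m is used when forced, or when the remainder is still at least the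
    -- smallest sum of k elements; otherwise it is dropped.
    by_cases hbig : k = m ∨ 2 * (l + m) + 2 * (k * l) + k * k ≤ 2 * t + k
    · have hge : 2 * (l + m) + 2 * (k * l) + k * k ≤ 2 * t + k := by
        rcases hbig with rfl | h
        · nlinarith
        · exact h
      have hkk : k ≤ k * k := Nat.le_mul_self k
      have hmem := ih (k := k) (t := t - (l + m)) (by omega) (by omega)
        (by nlinarith [Nat.sub_add_cancel (show l + m ≤ t by omega)])
      have : (t : ℤ) = (t - (l + m) : ℕ) + (l + m : ℕ) := by omega
      rw [this]
      exact add_mem_representedSet_append hmem (coe_mem_representedSet_of_mem h0 h1 (by simp))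
    · push Not at hbig
      have hkm' : k + 1 ≤ m := by omega
      refine representedSet_mono_of_sublist h0 (List.sublist_append_left _ _)
        (ih hkm' hlo ?_)
      have : k * (k + 1) ≤ k * m := by gcongr
      obtain ⟨c, hc⟩ := (Nat.even_mul_succ_self k).two_dvd
      have hlt := hbig.2
      ring_nf at this hc hlt ⊢
      omega

theorem range'_eq_append_append {n : ℕ} (hn : 16 ≤ n) :
    List.range' n n =
      List.range' n 8 ++ (List.range' (n + 8) (n - 16) ++ List.range' (2 * n - 8) 8) := by
  rw [show List.range' (2 * n - 8) 8 = List.range' (n + 8 + (n - 16)) 8 by congr 1; omega,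
    List.range'_append_1, List.range'_append_1]
  congr 1
  omega

theorem mem_cons_range'_of_ge {n e : ℕ} (hn : 34 ≤ n) (he : e = n ∨ e = 2 * n)
    {N : ℕ} (hN : n ≤ N) :
    (N : ℤ) ∈ representedSet (generalizedPolygonal 7) (e :: List.range' n n) := by
  rcases lt_or_ge N (3 * n + 27) with hlt | hge
  · by_cases h2 : N = 2 * n
    · subst h2
      rcases he with rfl | rfl
      · have hmem : (e : ℤ) ∈ representedSet (generalizedPolygonal 7) (List.range' e e) :=
          coe_mem_representedSet_of_mem zero_mem_heptagonal one_mem_heptagonal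
            (List.mem_range'_1.2 (by omega))
        exact mem_representedSet_cons.2 ⟨1, one_mem_heptagonal, _, hmem, by push_cast; ring⟩
      · exact coe_mem_representedSet_of_mem zero_mem_heptagonal one_mem_heptagonal (by simp)
    · refine representedSet_mono_of_sublist zero_mem_heptagonal (List.sublist_cons_self _ _) ?_
      have key := fun k => subsetSum_mem_range' (k := k) (l := n) (m := n) (t := N)
        zero_mem_heptagonal one_mem_heptagonal
      have h : N < 2 * n ∨ (2 * n < N ∧ N ≤ 4 * n - 3) ∨ 4 * n - 3 < N := by omega
      rcases h with h | h | h
      · exact key 1 (by omega) (by omega) (by omega)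
      · exact key 2 (by omega) (by omega) (by omega)
      · exact key 3 (by omega) (by omega) (by omega)
  · refine representedSet_mono_of_sublist zero_mem_heptagonal (List.sublist_cons_self _ _) ?_
    have hperm : (List.range' n n).Perm
        ((List.range' n 8 ++ List.range' (2 * n - 8) 8) ++ List.range' (n + 8) (n - 16)) := by
      rw [range'_eq_append_append (by omega), List.append_assoc]
      exact List.perm_append_comm.append_left _
    have hG : ∀ k : ℕ, ((5 * (3 * n - 1) * k : ℕ) : ℤ) ∈
        representedSet (generalizedPolygonal 7)
          (List.range' n 8 ++ List.range' (2 * n - 8) 8) := fun k => by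
      have : (List.range' n 8 ++ List.range' (2 * n - 8) 8).Perm
          (List.range' n 8 ++ (List.range' (2 * n - 8) 8).reverse) :=
        (List.reverse_perm _).symm.append_left _
      rw [representedSet_perm this]
      refine multiples_mem_of_eight_pairs ?_ ?_ ?_ ?_ ?_ ?_ ?_ ?_ k <;> omega
    rw [representedSet_perm hperm]
    refine mem_append_of_interval (A := 3 * n + 27) (by omega) hG (fun t h₁ h₂ => ?_) hge
    refine ⟨0, t, by omega, ?_⟩
    have key := fun k => subsetSum_mem_range' (k := k) (l := n + 8) (m := n - 16) (t := t)
      zero_mem_heptagonal one_mem_heptagonal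
    -- Each threshold is the least sum of k middle coefficients, k(n + 8) + k(k - 1)/2. The largest
    -- sum of three, 6n - 30, must reach 4n + 37, which requires n ≥ 34.
    by_cases c₄ : t < 4 * n + 38
    · exact key 3 (by omega) (by omega) (by omega)
    by_cases c₅ : t < 5 * n + 50
    · exact key 4 (by omega) (by omega) (by omega)
    by_cases c₆ : t < 6 * n + 63
    · exact key 5 (by omega) (by omega) (by omega)
    by_cases c₇ : t < 7 * n + 77
    · exact key 6 (by omega) (by omega) (by omega)
    by_cases c₈ : t < 8 * n + 92
    · exact key 7 (by omega) (by omega) (by omega)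
    by_cases c₉ : t < 9 * n + 108
    · exact key 8 (by omega) (by omega) (by omega)
    by_cases c₁₀ : t < 10 * n + 125
    · exact key 9 (by omega) (by omega) (by omega)
    by_cases c₁₁ : t < 11 * n + 143
    · exact key 10 (by omega) (by omega) (by omega)
    by_cases c₁₂ : t < 12 * n + 162
    · exact key 11 (by omega) (by omega) (by omega)
    · exact key 12 (by omega) (by omega) (by omega)

end LargeCases

/-! ### Tightness of both vectors and conclusion -/

theorem mem_cons_range' {n e : ℕ} (hn : 11 ≤ n) (he : e = n ∨ e = 2 * n) {N : ℕ} (hN : n ≤ N) :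
    (N : ℤ) ∈ representedSet (generalizedPolygonal 7) (e :: List.range' n n) := by
  rcases Nat.lt_or_ge n 34 with h | h
  · rcases hn.eq_or_lt with rfl | hn
    · exact mem_cons_range'_eleven he hN
    · exact mem_cons_range'_of_lt hn h he hN
  · exact mem_cons_range'_of_ge h he hN

theorem isTight_xVec {n : ℕ} (hn : 11 ≤ n) : IsTight (generalizedPolygonal 7) n (xVec n) := by
  refine isTight_of_forall_mem heptagonal_eq_zero_or_one_or_three_le (by omega) (fun c hc => ?_)
    fun N hN => mem_cons_range' hn (Or.inl rfl) hN
  rw [xVec, List.mem_cons, List.mem_range'_1] at hc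
  omega

theorem isTight_yVec {n : ℕ} (hn : 11 ≤ n) : IsTight (generalizedPolygonal 7) n (yVec n) := by
  refine isTight_of_forall_mem heptagonal_eq_zero_or_one_or_three_le (by omega) (fun c hc => ?_)
    fun N hN => ?_
  · exact (List.mem_range'_1.1 hc).1
  · have : (yVec n).Perm (2 * n :: List.range' n n) := by
      rw [yVec, List.range'_concat, one_mul, ← two_mul]
      exact List.perm_append_singleton _ _
    rw [representedSet_perm this]
    exact mem_cons_range' hn (Or.inr rfl) hN

end TightUniversal

theorem mainTheorem10 (n : ℕ) (hn : 11 ≤ n) :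
    ¬ (TightUniversal.xVec n).Perm (TightUniversal.yVec n) ∧
      ∀ a : List ℕ,
        TightUniversal.IsNewTight (TightUniversal.generalizedPolygonal 7) n a ↔
          a.Perm (TightUniversal.xVec n) ∨ a.Perm (TightUniversal.yVec n) :=
  ⟨TightUniversal.not_xVec_perm_yVec (by omega),
    TightUniversal.isNewTight_iff_perm TightUniversal.zero_mem_heptagonal
      TightUniversal.one_mem_heptagonal TightUniversal.heptagonal_eq_zero_or_one_or_three_le
      (by omega) (TightUniversal.isTight_xVec hn) (TightUniversal.isTight_yVec hn)⟩
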